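/- Let $L=C_2\wr\mathbb Z$ be the lamplighter group, i.e. the set of pairs $(n,A)$ with $n\in\mathbb Z$ and $A\subset\mathbb Z$ finite, with product $(n,A)(m,B)=(n+m,\,A\triangle(n+B))$, and let $D=\{(-1,\emptyset),(1,\emptyset),(1,\{0\}),(-1,\{-1\})\}$. For a group $\Gamma$ with a finite symmetric generating set $E\not\ni e$, let $G=\operatorname{Cay}(\Gamma,E)$ be the graph on $\Gamma$ with edges $(x,x\gamma)$, $\gamma\in E$, and let $\operatorname{Aut}_e(G)=\{f\in\operatorname{Aut}(G): f(e)=e\}$. A Cayley diagram on $G$ is a labelling $d$ of the oriented edges of $G$ by elements of $E$ such that at every vertex each $\gamma\in E$ labels exactly one outgoing edge, and a walk $(x_0,\dots,x_n)$ satisfies $d(x_0,x_1)\cdots d(x_{n-1},x_n)=e$ if and only if $x_0=x_n$. An $\operatorname{Aut}(G)$-f.i.i.d. Cayley diagram is a probability measure on $E$-labellings of the oriented edges of $G$ that is concentrated on Cayley diagrams and is the push-forward of $([0,1]^\Gamma,\lambda^\Gamma)$, $\lambda$ being Lebesgue measure, under a measurable map $\Phi$ such that for almost every $u$, $\Phi(f\cdot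 u)=f\cdot\Phi(u)$ for all $f\in\operatorname{Aut}(G)$, where $(f\cdot u)(x)=u(f^{-1}x)$ and $(f\cdot d)(x,y)=d(f^{-1}x,f^{-1}y)$. Let $T_3$ be the $3$-regular tree with a height function $h:T_3\to\mathbb Z$ such that every vertex $v$ has exactly one neighbour of height $h(v)-1$ and exactly two neighbours of height $h(v)+1$. The Diestel--Leader graph has vertex set $\{(v,w)\in T_3\times T_3: h(v)+h(w)=0\}$, with $(v,w)$ adjacent to $(v',w')$ when $v$ is adjacent to $v'$ and $w$ is adjacent to $w'$. **Theorem.** There is an action of $C_2=\langle t\rangle$ on $L$ by automorphisms with $t\cdot r=r^{-1}$ for all $r\in D$, and the finite extension $\Gamma=C_2\ltimes L$ of the lamplighter group has a finite symmetric generating set $E\not\ni e$ such that, for $G=\operatorname{Cay}(\Gamma,E)$: 1. the Diestel--Leader graph is a quotient of $G$: there is a finite subgroup $K\le\Gamma$ such that the graph obtained from $G$ by collapsing every left coset $xK$ to a point (two distinct cosets being adjacent when some element of one is adjacent in $G$ to some element of the other) is isomorphic to the Diestel--Leader graph; 2. $|\operatorname{Aut}_e(G)|>1$; 3. $G$ admits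 an $\operatorname{Aut}(G)$-f.i.i.d. Cayley diagram. -/

import Mathlib

open MeasureTheory

/-! ### The lamplighter group -/

/-- The lamplighter group `L = C₂ ≀ ℤ`: pairs `(n, A)` with `n ∈ ℤ` and `A ⊆ ℤ` finite. -/
@[ext]
structure Lamplighter where
  pos : ℤ
  lamps : Finset ℤ

namespace Lamplighter

/-- The translate `n + A` of a finite set of integers. -/
def shift (n : ℤ) (A : Finset ℤ) : Finset ℤ := A.map (Equiv.addLeft n).toEmbedding

theorem mem_shift {n : ℤ} {A : Finset ℤ} {k : ℤ} : k ∈ shift n A ↔ k - n ∈ A := by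
  simp only [shift, Finset.mem_map_equiv, Equiv.addLeft_symm, Equiv.coe_addLeft]
  rw [show -n + k = k - n by ring]

/-- `(n, A) · (m, B) = (n + m, A ∆ (n + B))`, with `(0, ∅)` as identity. -/
instance : Group Lamplighter where
  mul x y := ⟨x.pos + y.pos, symmDiff x.lamps (shift x.pos y.lamps)⟩
  one := ⟨0, ∅⟩
  inv x := ⟨-x.pos, shift (-x.pos) x.lamps⟩
  mul_assoc x y z := by
    apply Lamplighter.ext
    · exact add_assoc x.pos y.pos z.pos
    · change symmDiff (symmDiff x.lamps (shift x.pos y.lamps)) (shift (x.pos + y.pos) z.lamps)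
        = symmDiff x.lamps (shift x.pos (symmDiff y.lamps (shift y.pos z.lamps)))
      ext k
      simp only [Finset.mem_symmDiff, mem_shift, sub_sub]
      tauto
  one_mul x := by
    apply Lamplighter.ext
    · exact zero_add x.pos
    · change symmDiff ∅ (shift 0 x.lamps) = x.lamps
      ext k
      simp [Finset.mem_symmDiff, mem_shift]
  mul_one x := by
    apply Lamplighter.ext
    · exact add_zero x.pos
    · change symmDiff x.lamps (shift x.pos ∅) = x.lamps
      ext k
      simp [Finset.mem_symmDiff, mem_shift]
  inv_mul_cancel x := by
    apply Lamplighter.ext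
    · exact neg_add_cancel x.pos
    · change symmDiff (shift (-x.pos) x.lamps) (shift (-x.pos) x.lamps) = ∅
      simp

/-- The Diestel–Leader generators `(-1, ∅), (1, ∅), (1, {0}), (-1, {-1})`. -/
def dlGenerators : Set Lamplighter :=
  {⟨-1, ∅⟩, ⟨1, ∅⟩, ⟨1, {0}⟩, ⟨-1, {-1}⟩}

end Lamplighter

/-! ### The Diestel–Leader graph -/

/-- `h` is a height function on `T`: every vertex `v` has exactly one neighbour `w` with
`h v = h w + 1`, exactly two neighbours `w` with `h v = h w - 1`, and no others. -/
structure IsHeightFunction {V : Type*} (T : SimpleGraph V) (h : V → ℤ) : Prop where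
  one_below : ∀ v, {w | T.Adj v w ∧ h v = h w + 1}.ncard = 1
  two_above : ∀ v, {w | T.Adj v w ∧ h v = h w - 1}.ncard = 2
  no_other : ∀ v w, T.Adj v w → h v = h w + 1 ∨ h v = h w - 1

/-- The horocyclic product of `(T, h)` with itself: vertices are the pairs of heights summing to
zero, adjacency is adjacency in both coordinates. -/
def horocyclicProduct {V : Type*} (T : SimpleGraph V) (h : V → ℤ) :
    SimpleGraph {p : V × V // h p.1 + h p.2 = 0} where
  Adj p q := T.Adj p.1.1 q.1.1 ∧ T.Adj p.1.2 q.1.2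
  symm := ⟨fun _ _ hpq => ⟨hpq.1.symm, hpq.2.symm⟩⟩
  loopless := ⟨fun _ hp => T.irrefl hp.1⟩

/-- `X` is (a copy of) the Diestel–Leader graph: the horocyclic product with itself of the
3-regular tree with a height function (which is unique up to isomorphism). -/
def IsDiestelLeaderGraph {W : Type*} (X : SimpleGraph W) : Prop :=
  ∃ (V : Type) (T : SimpleGraph V) (h : V → ℤ),
    T.IsTree ∧ IsHeightFunction T h ∧ Nonempty (X ≃g horocyclicProduct T h)

/-! ### Cayley graphs, quotients, rotations -/

section Cayley

variable {Γ : Type*} [Group Γ]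

/-- `E` is a finite symmetric generating set of `Γ` without the identity. -/
structure IsMarking (E : Set Γ) : Prop where
  finite : E.Finite
  one_notMem : (1 : Γ) ∉ E
  inv_mem : ∀ γ ∈ E, γ⁻¹ ∈ E
  closure_eq_top : Subgroup.closure E = ⊤

/-- `Cay(Γ, E)`: vertex set `Γ`, edges `(x, xγ)` for `γ ∈ E`. -/
abbrev Cay (E : Set Γ) : SimpleGraph Γ := SimpleGraph.mulCayley E

/-- The quotient of a graph on `Γ` that collapses each left coset of `K` to a point: two distinct
cosets are adjacent when some element of one is adjacent to some element of the other. -/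
def cosetQuotient (G : SimpleGraph Γ) (K : Subgroup Γ) : SimpleGraph (Γ ⧸ K) where
  Adj u v := u ≠ v ∧ ∃ x y : Γ, (x : Γ ⧸ K) = u ∧ (y : Γ ⧸ K) = v ∧ G.Adj x y
  symm := ⟨fun _ _ ⟨hne, x, y, hx, hy, h⟩ => ⟨hne.symm, y, x, hy, hx, h.symm⟩⟩
  loopless := ⟨fun _ h => h.1 rfl⟩

/-- `Aut_e(G)`: the automorphisms of a graph on `Γ` that fix the identity element. -/
def rotations (G : SimpleGraph Γ) : Subgroup (G ≃g G) where
  carrier := {f | f 1 = 1}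
  one_mem' := rfl
  mul_mem' {f g} hf hg := by
    change f (g 1) = 1
    rw [show g 1 = 1 from hg]
    exact hf
  inv_mem' {f} hf := by
    change f.symm 1 = 1
    rw [← show f 1 = 1 from hf, RelIso.symm_apply_apply, show f 1 = 1 from hf]

/-! ### Cayley diagrams -/

/-- Labellings of the oriented edges of `Cay(Γ, E)` by elements of `E`. -/
def EdgeLabelling (E : Set Γ) : Type _ := (Cay E).Dart → E

/-- The product σ-algebra, for the discrete σ-algebra on `E`. -/
instance (E : Set Γ) : MeasurableSpace (EdgeLabelling E) :=
  @MeasurableSpace.pi (Cay E).Dart (fun _ => E) (fun _ => ⊤)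

/-- `(f · d)(x, y) = d(f⁻¹ x, f⁻¹ y)`. -/
def EdgeLabelling.act {E : Set Γ} (f : Cay E ≃g Cay E) (d : EdgeLabelling E) : EdgeLabelling E :=
  fun a => d (f.symm.toHom.mapDart a)

/-- `d` is a Cayley diagram: at every vertex each generator labels exactly one outgoing edge, and
a walk is closed if and only if the product of its labels is the identity. -/
structure IsCayleyDiagram {E : Set Γ} (d : EdgeLabelling E) : Prop where
  existsUnique_label : ∀ (x : Γ) (γ : E), ∃! a : (Cay E).Dart, a.fst = x ∧ d a = γ
  prod_eq_one_iff : ∀ {x y : Γ} (p : (Cay E).Walk x y),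
    (p.darts.map fun a => (d a : Γ)).prod = 1 ↔ x = y

/-- The law of i.i.d. uniform `[0,1]` labels on the elements of `Γ`. -/
noncomputable def iidMeasure (Γ : Type*) : Measure (Γ → unitInterval) :=
  Measure.infinitePi fun _ : Γ => (volume : Measure unitInterval)

/-- A measure `μ` on edge labellings is an `Aut(G)`-factor of i.i.d., `G = Cay(Γ, E)`: it is the
push-forward of the i.i.d. measure on `[0,1]^Γ` under a measurable map that is `Aut(G)`-equivariant
almost everywhere. The set of points at which equivariance holds simultaneously for all
automorphisms is itself invariant under `Aut(G)`. -/
def IsAutFIID {E : Set Γ} (μ : Measure (EdgeLabelling E)) : Prop :=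
  ∃ Φ : (Γ → unitInterval) → EdgeLabelling E, Measurable Φ ∧
    (∀ᵐ u ∂(iidMeasure Γ), ∀ f : Cay E ≃g Cay E,
      Φ (fun x => u (f.symm x)) = EdgeLabelling.act f (Φ u)) ∧
    μ = (iidMeasure Γ).map Φ

/-- `G = Cay(Γ, E)` admits an `Aut(G)`-f.i.i.d. Cayley diagram. -/
def AdmitsAutFIIDCayleyDiagram (E : Set Γ) : Prop :=
  ∃ μ : Measure (EdgeLabelling E), IsAutFIID μ ∧ ∀ᵐ d ∂μ, IsCayleyDiagram d

end Cayley

/-! The reflection `(n, A) ↦ (-n, -1 - A)` inverts the four Diestel–Leader generators. As `marking`,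
take all elements whose `L`-component is a step `(±1, ∅)` or a switch `(0, {-1})`, `(0, {0})`. Then
`G` is the Cayley graph of `L` for steps and switches with every vertex doubled (`adj_iff`), and
swapping two twins gives a nontrivial rotation.

The base graph is rigid. Vertices with equal neighbourhoods are twins, so an automorphism acts on
`L`. Four-cycles order the four edges at a vertex into a path, leaving only the identity or the
reversal, which is the reflection, and the choice is the same at every vertex (`exists_reflectHom`).
Hence, up to moves inside fibres, an automorphism is a left translation by an element of `Γ`.

A Cayley diagram therefore only needs an identification of each fibre with `C₂` that an automorphism
of type `η` multiplies by `η`. Almost surely all labels are distinct. Comparing the two labels of a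
fibre gives an invariant bit, and comparing the fibres one step ahead and behind gives a bit that
reflections flip; their product is the required `sheet` (`sheet_apply`).

Collapsing cosets of the finite group generated by the two switches and `C₂` forgets the two lamps
beside the position. The lamps below and above are then the two tree coordinates, and steps become
the edges (`horocyclic_adj_iff`). -/

namespace Lamplighter

/-! ### Coordinates and the reflection on the lamplighter group. -/

@[simp] theorem pos_one : (1 : Lamplighter).pos = 0 := rfl

@[simp] theorem lamps_one : (1 : Lamplighter).lamps = ∅ := rfl

@[simp] theorem pos_mul (x y : Lamplighter) : (x * y).pos = x.pos + y.pos := rfl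

@[simp] theorem pos_inv (x : Lamplighter) : x⁻¹.pos = -x.pos := rfl

theorem lamps_mul (x y : Lamplighter) :
    (x * y).lamps = symmDiff x.lamps (shift x.pos y.lamps) := rfl

theorem lamps_inv (x : Lamplighter) : x⁻¹.lamps = shift (-x.pos) x.lamps := rfl

theorem mem_lamps_mul {x y : Lamplighter} {k : ℤ} :
    k ∈ (x * y).lamps ↔ Xor (k ∈ x.lamps) (k - x.pos ∈ y.lamps) := by
  rw [lamps_mul, Finset.mem_symmDiff, mem_shift, Xor]

theorem mem_lamps_inv {x : Lamplighter} {k : ℤ} : k ∈ x⁻¹.lamps ↔ k + x.pos ∈ x.lamps := by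
  rw [lamps_inv, mem_shift, sub_neg_eq_add]

theorem mem_lamps_inv_mul {x y : Lamplighter} {k : ℤ} :
    k ∈ (x⁻¹ * y).lamps ↔ Xor (k + x.pos ∈ x.lamps) (k + x.pos ∈ y.lamps) := by
  rw [mem_lamps_mul, mem_lamps_inv, pos_inv, sub_neg_eq_add]

theorem ext_mem {x y : Lamplighter} (hp : x.pos = y.pos)
    (hl : ∀ k, k ∈ x.lamps ↔ k ∈ y.lamps) : x = y :=
  Lamplighter.ext hp (Finset.ext hl)

instance : DecidableEq Lamplighter := fun x y =>
  decidable_of_iff (x.pos = y.pos ∧ x.lamps = y.lamps) Lamplighter.ext_iff.symm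

instance : Countable Lamplighter :=
  Function.Injective.countable (f := fun x : Lamplighter => (x.pos, x.lamps))
    fun _ _ h => Lamplighter.ext (congrArg Prod.fst h) (congrArg Prod.snd h)

/-- The reflection `(n, A) ↦ (-n, -1 - A)`. -/
def reflect (x : Lamplighter) : Lamplighter :=
  ⟨-x.pos, x.lamps.map (Equiv.subLeft (-1 : ℤ)).toEmbedding⟩

theorem mem_lamps_reflect {x : Lamplighter} {k : ℤ} :
    k ∈ x.reflect.lamps ↔ -1 - k ∈ x.lamps := by
  simp only [reflect, Finset.mem_map_equiv, Equiv.subLeft_symm_apply]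
  rw [show -k + -1 = -1 - k by ring]

theorem reflect_reflect (x : Lamplighter) : x.reflect.reflect = x := by
  refine ext_mem (neg_neg _) fun k => ?_
  rw [mem_lamps_reflect, mem_lamps_reflect, sub_sub_cancel]

theorem reflect_mul (x y : Lamplighter) : (x * y).reflect = x.reflect * y.reflect := by
  refine ext_mem (neg_add _ _) fun k => ?_
  rw [mem_lamps_reflect, mem_lamps_mul, mem_lamps_mul, mem_lamps_reflect, mem_lamps_reflect,
    show -1 - (k - x.reflect.pos) = -1 - k - x.pos by simp only [reflect]; ring]

/-- `reflect` as an automorphism. -/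
def reflectAut : MulAut Lamplighter where
  toFun := reflect
  invFun := reflect
  left_inv := reflect_reflect
  right_inv := reflect_reflect
  map_mul' := reflect_mul

theorem reflectAut_mul_self : reflectAut * reflectAut = 1 :=
  MulEquiv.ext reflect_reflect

end Lamplighter

/-- The cyclic group of order two, written multiplicatively. -/
abbrev C₂ : Type := Multiplicative (ZMod 2)

namespace C₂

/-- The generator of `C₂`. -/
abbrev gen : C₂ := Multiplicative.ofAdd 1

theorem eq_one_or (η : C₂) : η = 1 ∨ η = gen := by
  revert η; decide

theorem gen_ne_one : gen ≠ 1 := by decide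

theorem gen_mul_gen : gen * gen = 1 := by decide

end C₂

/-! ### The action of `C₂` and the step–switch generators. -/

namespace Lamplighter

/-- The action of `C₂` on the lamplighter group in which the generator acts by `reflect`. -/
def reflectHom : C₂ →* MulAut Lamplighter where
  toFun η := if η = 1 then 1 else reflectAut
  map_one' := if_pos rfl
  map_mul' η θ := by
    rcases C₂.eq_one_or η with rfl | rfl <;> rcases C₂.eq_one_or θ with rfl | rfl <;>
      simp [C₂.gen_mul_gen, reflectAut_mul_self]

theorem reflectHom_gen (x : Lamplighter) : reflectHom C₂.gen x = x.reflect := by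
  simp [reflectHom, reflectAut]

/-- The centre of reflection matters: the inverse of `(1, {0})` is `(-1, {-1})`, so lamps must go by
`k ↦ -1 - k` and not `k ↦ -k`. -/
theorem reflectHom_gen_of_mem_dlGenerators {r : Lamplighter} (hr : r ∈ dlGenerators) :
    reflectHom C₂.gen r = r⁻¹ := by
  rw [reflectHom_gen]
  rcases hr with rfl | rfl | rfl | rfl <;> decide

/-- The generators `(-1, ∅), (0, {-1}), (0, {0}), (1, ∅)`: steps, and switches of the lamp just
behind or just ahead. -/
def stepSwitch : Fin 4 → Lamplighter :=
  ![⟨-1, ∅⟩, ⟨0, {-1}⟩, ⟨0, {0}⟩, ⟨1, ∅⟩]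

theorem stepSwitch_injective : Function.Injective stepSwitch := by decide

theorem reflect_stepSwitch (i : Fin 4) : (stepSwitch i).reflect = stepSwitch i.rev := by
  revert i; decide

theorem exists_stepSwitch_eq_inv (i : Fin 4) : ∃ j, stepSwitch j = (stepSwitch i)⁻¹ := by
  revert i; decide

theorem stepSwitch_ne_one (i : Fin 4) : stepSwitch i ≠ 1 := by
  revert i; decide

/-- Two neighbours of a vertex span a four-cycle with it exactly when their labels are
consecutive. -/
theorem stepSwitch_corner (i j : Fin 4) :
    (i ≠ j ∧ ∃ k l, stepSwitch i * stepSwitch k = stepSwitch j * stepSwitch l ∧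
      stepSwitch i * stepSwitch k ≠ 1) ↔ (i.val + 1 = j.val ∨ j.val + 1 = i.val) := by
  revert i j; decide

/-- Injectivity forbids backtracking, and a walk of three edges without backtracking in the path
0–1–2–3 must run from one end to the other. -/
theorem eq_id_or_rev_of_path (π : Fin 4 → Fin 4) (hπ : ∀ i j : Fin 4,
    (i.val + 1 = j.val ∨ j.val + 1 = i.val) →
      ((π i).val + 1 = (π j).val ∨ (π j).val + 1 = (π i).val))
    (hi : Function.Injective π) : (∀ i, π i = i) ∨ ∀ i, π i = i.rev := by
  have h01 := hπ 0 1 (by decide)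
  have h12 := hπ 1 2 (by decide)
  have h23 := hπ 2 3 (by decide)
  have h02 := hi.ne (show (0 : Fin 4) ≠ 2 by decide)
  have h13 := hi.ne (show (1 : Fin 4) ≠ 3 by decide)
  simp only [Fin.forall_fin_succ, Fin.ext_iff, ne_eq] at *
  simp [Fin.rev] at *
  omega

theorem closure_range_stepSwitch : Subgroup.closure (Set.range stepSwitch) = ⊤ := by
  set H := Subgroup.closure (Set.range stepSwitch)
  have step (n : ℤ) : (⟨n, ∅⟩ : Lamplighter) ∈ H := by
    have h1 : (⟨1, ∅⟩ : Lamplighter) ∈ H := Subgroup.subset_closure ⟨3, rfl⟩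
    have h2 : (⟨-1, ∅⟩ : Lamplighter) ∈ H := Subgroup.subset_closure ⟨0, rfl⟩
    induction n with
    | zero => exact H.one_mem
    | succ n ih => exact H.mul_mem ih h1
    | pred n ih => exact H.mul_mem ih h2
  have switch (k : ℤ) : (⟨0, {k}⟩ : Lamplighter) ∈ H := by
    have h : (⟨0, {0}⟩ : Lamplighter) ∈ H := Subgroup.subset_closure ⟨2, rfl⟩
    have := H.mul_mem (H.mul_mem (step k) h) (step (-k))
    convert this using 1
    refine ext_mem (by simp) fun j => ?_
    simp [mem_lamps_mul, sub_eq_zero, Xor]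
  refine eq_top_iff.2 fun ⟨n, A⟩ _ => ?_
  induction A using Finset.induction_on with
  | empty => exact step n
  | insert k A hk ih =>
    have := H.mul_mem (switch k) (ih trivial)
    convert this using 1
    refine ext_mem (by simp) fun j => ?_
    simp only [mem_lamps_mul, Finset.mem_insert, Finset.mem_singleton, sub_zero, Xor]
    by_cases hj : j = k
    · subst hj; simp [hk]
    · simp [hj]

end Lamplighter

/-! ### The extension and its marking. -/

/-- The extension `C₂ ⋉ L` of the lamplighter group by the reflection. -/
abbrev ReflectedLamplighter : Type := Lamplighter ⋊[Lamplighter.reflectHom] C₂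

namespace ReflectedLamplighter

open Lamplighter

instance : DecidableEq ReflectedLamplighter := fun _ _ =>
  decidable_of_iff _ SemidirectProduct.ext_iff.symm

instance : Countable ReflectedLamplighter :=
  Function.Injective.countable (f := fun x : ReflectedLamplighter => (x.left, x.right))
    fun _ _ h => SemidirectProduct.ext (congrArg Prod.fst h) (congrArg Prod.snd h)

/-- The elements of `C₂ ⋉ L` whose `L`-component is a step or a switch. -/
def marking : Set ReflectedLamplighter := {γ | γ.left ∈ Set.range stepSwitch}

theorem reflectHom_mem_range_iff (η : C₂) (r : Lamplighter) :
    reflectHom η r ∈ Set.range stepSwitch ↔ r ∈ Set.range stepSwitch := by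
  rcases C₂.eq_one_or η with rfl | rfl
  · simp
  · rw [reflectHom_gen]
    constructor
    · rintro ⟨i, hi⟩
      exact ⟨i.rev, by rw [← reflect_stepSwitch, hi, reflect_reflect]⟩
    · rintro ⟨i, rfl⟩
      exact ⟨i.rev, (reflect_stepSwitch i).symm⟩

theorem left_inv_mul (x y : ReflectedLamplighter) :
    (x⁻¹ * y).left = reflectHom x.right⁻¹ (x.left⁻¹ * y.left) := by
  simp

theorem inv_mul_mem_marking_iff {x y : ReflectedLamplighter} :
    x⁻¹ * y ∈ marking ↔ ∃ i, y.left = x.left * stepSwitch i := by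
  rw [marking, Set.mem_ofPred_eq, left_inv_mul, reflectHom_mem_range_iff]
  exact exists_congr fun i => by rw [eq_inv_mul_iff_mul_eq, eq_comm]

theorem inv_mem_marking {γ : ReflectedLamplighter} (hγ : γ ∈ marking) : γ⁻¹ ∈ marking := by
  obtain ⟨i, hi⟩ := hγ
  obtain ⟨j, hj⟩ := exists_stepSwitch_eq_inv i
  rw [← mul_one γ⁻¹, inv_mul_mem_marking_iff]
  exact ⟨j, by rw [hj, hi, mul_inv_cancel]; rfl⟩

theorem one_notMem_marking : (1 : ReflectedLamplighter) ∉ marking :=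
  fun ⟨i, hi⟩ => stepSwitch_ne_one i hi

/-- The set of steps and switches is invariant under reflection, so adjacency ignores the
`C₂`-components. -/
theorem adj_iff {x y : ReflectedLamplighter} :
    (Cay marking).Adj x y ↔ ∃ i, y.left = x.left * stepSwitch i := by
  rw [← inv_mul_mem_marking_iff, SimpleGraph.mulCayley_adj]
  constructor
  · rintro ⟨-, h | h⟩
    · exact h
    · simpa using inv_mem_marking h
  · refine fun h => ⟨?_, Or.inl h⟩
    rintro rfl
    exact one_notMem_marking (by simpa using h)

theorem isMarking_marking : IsMarking marking where
  finite := by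
    refine Set.Finite.of_finite_image (f := fun γ : ReflectedLamplighter => (γ.left, γ.right))
      (((Set.finite_range stepSwitch).prod Set.finite_univ).subset ?_) ?_
    · rintro _ ⟨γ, hγ, rfl⟩
      exact ⟨hγ, trivial⟩
    · intro _ _ _ _ h
      exact SemidirectProduct.ext (congrArg Prod.fst h) (congrArg Prod.snd h)
  one_notMem := one_notMem_marking
  inv_mem _ := inv_mem_marking
  closure_eq_top := by
    set H := Subgroup.closure marking
    have hl (l : Lamplighter) : SemidirectProduct.inl l ∈ H := by
      have : Subgroup.closure (Set.range stepSwitch) ≤ H.comap SemidirectProduct.inl :=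
        (Subgroup.closure_le _).2 fun r hr => Subgroup.subset_closure hr
      rw [closure_range_stepSwitch] at this
      exact this trivial
    have hg (η : C₂) : SemidirectProduct.inr η ∈ H := by
      -- Generators with the same `L`-component differ by an element of `C₂`.
      have : (⟨stepSwitch 0, η⟩ : ReflectedLamplighter) ∈ H :=
        Subgroup.subset_closure ⟨0, rfl⟩
      convert H.mul_mem (H.inv_mem (hl (stepSwitch 0))) this using 1
      ext1 <;> simp
    refine eq_top_iff.2 fun γ _ => ?_
    rw [← SemidirectProduct.inl_left_mul_inr_right γ]
    exact H.mul_mem (hl _) (hg _)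

/-! ### Automorphisms of the Cayley graph -/

/-- The other element of the fibre of `left` through `x`. -/
def twin (x : ReflectedLamplighter) : ReflectedLamplighter := ⟨x.left, x.right * C₂.gen⟩

theorem eq_or_eq_twin {x y : ReflectedLamplighter} (h : y.left = x.left) :
    y = x ∨ y = twin x := by
  rcases C₂.eq_one_or (x.right⁻¹ * y.right) with h' | h'
  · exact Or.inl (SemidirectProduct.ext h (inv_mul_eq_one.1 h').symm)
  · exact Or.inr (SemidirectProduct.ext h (inv_mul_eq_iff_eq_mul.1 h'))

theorem twin_ne (x : ReflectedLamplighter) : twin x ≠ x := fun h =>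
  C₂.gen_ne_one (mul_eq_left.1 (congrArg SemidirectProduct.right h))

theorem twin_twin (x : ReflectedLamplighter) : twin (twin x) = x :=
  SemidirectProduct.ext rfl (by simp [twin, mul_assoc, C₂.gen_mul_gen])

/-- This recovers the fibres from the graph alone. With equal neighbourhoods, the difference of the
`L`-components has the form `s₀ sⱼ⁻¹`, of position at most 0, and also `s₃ sₖ⁻¹`, of position at
least 0; position 0 forces `j = 0`. -/
theorem left_eq_iff_neighbours {x y : ReflectedLamplighter} :
    x.left = y.left ↔ ∀ z, (Cay marking).Adj x z ↔ (Cay marking).Adj y z := by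
  refine ⟨fun h z => by rw [adj_iff, adj_iff, h], fun h => ?_⟩
  have key (i : Fin 4) : ∃ j, x.left * stepSwitch i = y.left * stepSwitch j :=
    adj_iff.1 ((h ⟨x.left * stepSwitch i, 1⟩).1 (adj_iff.2 ⟨i, rfl⟩))
  have key' (i : Fin 4) : ∃ j, stepSwitch i * (stepSwitch j)⁻¹ = x.left⁻¹ * y.left := by
    obtain ⟨j, hj⟩ := key i
    exact ⟨j, by rw [mul_inv_eq_iff_eq_mul, mul_assoc, ← hj, inv_mul_cancel_left]⟩
  obtain ⟨j, hj⟩ := key' 0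
  obtain ⟨k, hk⟩ := key' 3
  have : ∀ j k, stepSwitch 0 * (stepSwitch j)⁻¹ = stepSwitch 3 * (stepSwitch k)⁻¹ →
      stepSwitch 0 * (stepSwitch j)⁻¹ = 1 := by decide
  rw [← inv_mul_eq_one, ← hj]
  exact this j k (hj.trans hk.symm)

variable (f : Cay marking ≃g Cay marking)

theorem left_apply_eq_iff {x y : ReflectedLamplighter} :
    (f x).left = (f y).left ↔ x.left = y.left := by
  rw [left_eq_iff_neighbours, left_eq_iff_neighbours, f.surjective.forall]
  simp only [f.map_adj_iff]

theorem apply_twin (x : ReflectedLamplighter) : f (twin x) = twin (f x) :=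
  (eq_or_eq_twin ((left_apply_eq_iff f).2 (show (twin x).left = x.left from rfl))).resolve_left
    (f.injective.ne (twin_ne x))

/-- The map induced on `L` by an automorphism of the Cayley graph. -/
def baseMap (l : Lamplighter) : Lamplighter := (f ⟨l, 1⟩).left

theorem left_apply (x : ReflectedLamplighter) : (f x).left = baseMap f x.left :=
  (left_apply_eq_iff f).2 rfl

theorem baseMap_injective : Function.Injective (baseMap f) := fun _ _ h =>
  (left_apply_eq_iff f).1 h

theorem exists_baseMap_mul (l : Lamplighter) (i : Fin 4) :
    ∃ j, baseMap f (l * stepSwitch i) = baseMap f l * stepSwitch j :=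
  adj_iff.1 (f.map_adj_iff.2 (adj_iff.2 ⟨i, rfl⟩ :
    (Cay marking).Adj ⟨l, 1⟩ ⟨l * stepSwitch i, 1⟩))

/-- Four-cycles through `l` are carried to four-cycles, so the permutation of the labels at `l`
preserves the path of `stepSwitch_corner`. -/
theorem exists_reflectHom_local (l : Lamplighter) :
    ∃ η : C₂, ∀ i, baseMap f (l * stepSwitch i) = baseMap f l * reflectHom η (stepSwitch i) := by
  choose π hπ using exists_baseMap_mul f l
  have hinj : Function.Injective π := fun i j hij => by
    have := (hπ i).trans ((congrArg (fun k => baseMap f l * stepSwitch k) hij).trans (hπ j).symm)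
    exact stepSwitch_injective (mul_left_cancel (baseMap_injective f this))
  have hpath (i j : Fin 4) (hij : i.val + 1 = j.val ∨ j.val + 1 = i.val) :
      (π i).val + 1 = (π j).val ∨ (π j).val + 1 = (π i).val := by
    rw [← stepSwitch_corner] at hij ⊢
    obtain ⟨hne, k, m, hkm, h1⟩ := hij
    refine ⟨hinj.ne hne, ?_⟩
    obtain ⟨k', hk'⟩ := exists_baseMap_mul f (l * stepSwitch i) k
    obtain ⟨m', hm'⟩ := exists_baseMap_mul f (l * stepSwitch j) m
    rw [hπ, mul_assoc, mul_assoc] at hk' hm'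
    refine ⟨k', m', ?_, fun h => h1 ?_⟩
    · rw [hkm, hm'] at hk'
      exact (mul_left_cancel hk').symm
    · rw [h, mul_one] at hk'
      exact mul_eq_left.1 (baseMap_injective f hk')
  rcases eq_id_or_rev_of_path π hpath hinj with h | h
  · exact ⟨1, fun i => by rw [hπ, h]; rfl⟩
  · exact ⟨C₂.gen, fun i => by rw [hπ, h, reflectHom_gen, reflect_stepSwitch]⟩

/-- An edge can be read from either end, and reflection fixes no step or switch; so the type `η`
agrees at both ends, hence everywhere since the generators generate `L`. -/
theorem exists_reflectHom : ∃ η : C₂, ∀ l i,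
    baseMap f (l * stepSwitch i) = baseMap f l * reflectHom η (stepSwitch i) := by
  choose η hη using exists_reflectHom_local f
  have step (l : Lamplighter) (i : Fin 4) : η (l * stepSwitch i) = η l := by
    obtain ⟨j, hj⟩ := exists_stepSwitch_eq_inv i
    have h := hη (l * stepSwitch i) j
    rw [hj, mul_inv_cancel_right, hη l i, mul_assoc, eq_comm, mul_eq_left, map_inv,
      mul_inv_eq_one] at h
    have faithful : ∀ i : Fin 4, (stepSwitch i).reflect ≠ stepSwitch i := by decide
    rcases C₂.eq_one_or (η l) with h1 | h1 <;>
      rcases C₂.eq_one_or (η (l * stepSwitch i)) with h2 | h2 <;> rw [h1, h2] at h ⊢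
    · exact absurd (by rw [← reflectHom_gen, ← h]; rfl) (faithful i)
    · exact absurd (by rw [← reflectHom_gen, h]; rfl) (faithful i)
  have const (r : Lamplighter) : ∀ l, η (l * r) = η l := by
    have hr : r ∈ Subgroup.closure (Set.range stepSwitch) := closure_range_stepSwitch ▸ trivial
    induction hr using Subgroup.closure_induction with
    | mem r hr => obtain ⟨i, rfl⟩ := hr; exact fun l => step l i
    | one => simp
    | mul r s _ _ hr hs => exact fun l => by rw [← mul_assoc, hs, hr]
    | inv r _ hr => exact fun l => by rw [← hr (l * r⁻¹), inv_mul_cancel_right]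
  refine ⟨η 1, fun l i => ?_⟩
  rw [hη, ← const l 1, one_mul]

theorem reflectHom_inv_mul_baseMap {η : C₂} (hη : ∀ l i,
    baseMap f (l * stepSwitch i) = baseMap f l * reflectHom η (stepSwitch i))
    {x y : ReflectedLamplighter} (h : (Cay marking).Adj x y) :
    (f x).left⁻¹ * (f y).left = reflectHom η (x.left⁻¹ * y.left) := by
  obtain ⟨i, hi⟩ := adj_iff.1 h
  rw [left_apply, left_apply, hi, hη, inv_mul_cancel_left, inv_mul_cancel_left]

/-- Swapping the two vertices of a single fibre away from the identity preserves adjacency. -/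
theorem nontrivial_rotations : Nontrivial (rotations (Cay marking)) := by
  let a : ReflectedLamplighter := ⟨stepSwitch 3, 1⟩
  let e : ReflectedLamplighter ≃ ReflectedLamplighter := Equiv.swap a (twin a)
  have he (x) : (e x).left = x.left := by
    simp only [e, Equiv.swap_apply_def]
    split_ifs with h1 h2
    · rw [h1]; rfl
    · rw [h2]; rfl
    · rfl
  let f : Cay marking ≃g Cay marking := ⟨e, by simp only [adj_iff, he, implies_true]⟩
  have hf : f 1 = 1 := by
    change Equiv.swap a (twin a) 1 = 1
    refine Equiv.swap_apply_of_ne_of_ne (fun h => ?_) (fun h => ?_) <;>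
      exact stepSwitch_ne_one 3 (congrArg SemidirectProduct.left h).symm
  refine ⟨⟨⟨f, hf⟩, 1, fun h => twin_ne a ?_⟩⟩
  have h1 : f a = twin a := Equiv.swap_apply_left a (twin a)
  have h2 : f a = a := congrArg (fun g : rotations (Cay marking) => g.1 a) h
  exact h1.symm.trans h2

end ReflectedLamplighter

/-! ### Almost sure distinctness of i.i.d. labels. -/

section IIDLabels

/-- Two coordinates are independent, so their joint law is a product of atomless measures and the
diagonal is null. -/
theorem iidMeasure_apply_eq_apply {Γ : Type*} {x y : Γ} (h : x ≠ y) :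
    iidMeasure Γ {u | u x = u y} = 0 := by
  have hind : ProbabilityTheory.iIndepFun (fun (i : Γ) (u : Γ → unitInterval) => u i)
      (iidMeasure Γ) :=
    ProbabilityTheory.iIndepFun_infinitePi (P := fun _ : Γ => (volume : Measure unitInterval))
      (X := fun _ => id) fun _ => measurable_id
  have : IsProbabilityMeasure (iidMeasure Γ) := by unfold iidMeasure; infer_instance
  have hmap := (ProbabilityTheory.indepFun_iff_map_prod_eq_prod_map_map
    (measurable_pi_apply x).aemeasurable (measurable_pi_apply y).aemeasurable).1 (hind.indepFun h)
  have heval (i : Γ) : (iidMeasure Γ).map (fun u => u i) = volume :=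
    Measure.infinitePi_map_eval (fun _ : Γ => (volume : Measure unitInterval)) i
  rw [heval, heval] at hmap
  have hd : MeasurableSet (Set.diagonal unitInterval) := measurableSet_diagonal
  have hpre : {u : Γ → unitInterval | u x = u y} =
      (fun u => (u x, u y)) ⁻¹' Set.diagonal unitInterval := rfl
  rw [hpre, ← Measure.map_apply (by fun_prop) hd, hmap, Measure.measure_prod_null hd]
  refine Filter.Eventually.of_forall fun t => ?_
  have : Prod.mk t ⁻¹' Set.diagonal unitInterval = {t} := by
    ext s; simp [eq_comm]
  change volume (Prod.mk t ⁻¹' Set.diagonal unitInterval) = 0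
  rw [this, measure_singleton]

theorem ae_injective_iidMeasure (Γ : Type*) [Countable Γ] :
    ∀ᵐ u ∂(iidMeasure Γ), Function.Injective u := by
  have : ∀ᵐ u ∂(iidMeasure Γ), ∀ x y : Γ, x ≠ y → u x ≠ u y := by
    rw [ae_all_iff]; intro x
    rw [ae_all_iff]; intro y
    by_cases h : x = y
    · simp [h]
    · refine (measure_eq_zero_iff_ae_notMem.1 (iidMeasure_apply_eq_apply h)).mono fun u hu _ => hu
  filter_upwards [this] with u hu x y hxy
  by_contra h
  exact hu x y h hxy

end IIDLabels

namespace ReflectedLamplighter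

open Lamplighter

/-! ### The factor map -/

/-- The larger of the two labels in the fibre over `l`. -/
noncomputable def fibreMax (u : ReflectedLamplighter → unitInterval) (l : Lamplighter) :
    unitInterval :=
  max (u ⟨l, 1⟩) (u ⟨l, C₂.gen⟩)

open Classical in
/-- The comparison of the two labels in the fibre of `x`, corrected by the comparison of the
fibres a step forward and a step backward from `x`. -/
noncomputable def sheet (u : ReflectedLamplighter → unitInterval) (x : ReflectedLamplighter) :
    C₂ :=
  (if u (twin x) < u x then C₂.gen else 1) *
    if fibreMax u (x.left * stepSwitch 0) < fibreMax u (x.left * stepSwitch 3) then C₂.gen else 1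

/-- The reordering of each fibre of `left` determined by `sheet`. -/
noncomputable def reorder (u : ReflectedLamplighter → unitInterval) (x : ReflectedLamplighter) :
    ReflectedLamplighter :=
  ⟨x.left, sheet u x⟩

theorem inv_mul_mem_marking_of_left_eq {x y x' y' : ReflectedLamplighter}
    (hx : x'.left = x.left) (hy : y'.left = y.left) (h : (Cay marking).Adj x y) :
    x'⁻¹ * y' ∈ marking := by
  rw [inv_mul_mem_marking_iff, hx, hy]
  exact adj_iff.1 h

/-- The labelling of the edges of the Cayley graph read off after reordering the fibres. -/
noncomputable def diagramOfLabels (u : ReflectedLamplighter → unitInterval) :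
    EdgeLabelling marking :=
  fun a => ⟨(reorder u a.fst)⁻¹ * reorder u a.snd,
    inv_mul_mem_marking_of_left_eq (x := a.fst) (y := a.snd) rfl rfl a.adj⟩

theorem fibreMax_left (u : ReflectedLamplighter → unitInterval) (x : ReflectedLamplighter) :
    fibreMax u x.left = max (u x) (u (twin x)) := by
  obtain ⟨l, η⟩ := x
  rcases C₂.eq_one_or η with rfl | rfl
  · rfl
  · rw [show twin ⟨l, C₂.gen⟩ = ⟨l, 1⟩ from SemidirectProduct.ext rfl C₂.gen_mul_gen]
    exact max_comm (u ⟨l, 1⟩) (u ⟨l, C₂.gen⟩)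

variable {u : ReflectedLamplighter → unitInterval}

theorem fibreMax_injective (hu : Function.Injective u) : Function.Injective (fibreMax u) := by
  intro l m h
  unfold fibreMax at h
  rcases max_choice (u ⟨l, 1⟩) (u ⟨l, C₂.gen⟩) with h1 | h1 <;>
    rcases max_choice (u ⟨m, 1⟩) (u ⟨m, C₂.gen⟩) with h2 | h2 <;>
    rw [h1, h2] at h <;> exact congrArg SemidirectProduct.left (hu h)

/-- Passing to the twin reverses the comparison inside the fibre, while the correcting factor
depends only on the fibre. Hence `sheet` takes both values on each fibre. -/
theorem sheet_twin (hu : Function.Injective u) (x : ReflectedLamplighter) :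
    sheet u (twin x) = sheet u x * C₂.gen := by
  have hne : u (twin x) ≠ u x := hu.ne (twin_ne x)
  have : (if u x < u (twin x) then C₂.gen else 1) =
      (if u (twin x) < u x then C₂.gen else 1) * C₂.gen := by
    rcases hne.lt_or_gt with h | h
    · rw [if_pos h, if_neg h.not_gt, C₂.gen_mul_gen]
    · rw [if_pos h, if_neg h.not_gt, one_mul]
  unfold sheet
  rw [twin_twin, this, mul_right_comm]
  rfl

theorem reorder_bijective (hu : Function.Injective u) : Function.Bijective (reorder u) := by
  constructor
  · intro x y h
    have hl : (reorder u x).left = (reorder u y).left := by rw [h]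
    change x.left = y.left at hl
    refine (eq_or_eq_twin hl).resolve_right ?_
    rintro rfl
    have hr : sheet u (twin y) = sheet u y := congrArg SemidirectProduct.right h
    rw [sheet_twin hu] at hr
    exact C₂.gen_ne_one (mul_eq_left.1 hr)
  · rintro ⟨l, η⟩
    rcases C₂.eq_one_or ((sheet u ⟨l, 1⟩)⁻¹ * η) with h | h
    · exact ⟨⟨l, 1⟩, SemidirectProduct.ext rfl (inv_mul_eq_one.1 h)⟩
    · refine ⟨twin ⟨l, 1⟩, SemidirectProduct.ext rfl ?_⟩
      exact (sheet_twin hu _).trans (inv_mul_eq_iff_eq_mul.1 h).symm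

/-- The product telescopes, so detecting closed walks reduces to injectivity of `reorder`. -/
theorem prod_darts_diagramOfLabels (u : ReflectedLamplighter → unitInterval)
    {x y : ReflectedLamplighter} (p : (Cay marking).Walk x y) :
    (p.darts.map fun a => (diagramOfLabels u a : ReflectedLamplighter)).prod =
      (reorder u x)⁻¹ * reorder u y := by
  induction p with
  | nil => simp
  | cons h p ih =>
    rw [SimpleGraph.Walk.darts_cons, List.map_cons, List.prod_cons, ih]
    simp only [diagramOfLabels]
    group

theorem isCayleyDiagram_diagramOfLabels (hu : Function.Injective u) :
    IsCayleyDiagram (diagramOfLabels u) where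
  existsUnique_label x γ := by
    obtain ⟨y, hy⟩ := (reorder_bijective hu).2 (reorder u x * γ)
    have hadj : (Cay marking).Adj x y := by
      have : (reorder u x)⁻¹ * reorder u y ∈ marking := by
        rw [hy, inv_mul_cancel_left]; exact γ.2
      obtain ⟨i, hi⟩ := inv_mul_mem_marking_iff.1 this
      exact adj_iff.2 ⟨i, hi⟩
    refine ⟨⟨(x, y), hadj⟩, ⟨rfl, Subtype.ext ?_⟩, ?_⟩
    · change (reorder u x)⁻¹ * reorder u y = γ
      rw [hy, inv_mul_cancel_left]
    · rintro ⟨⟨x', y'⟩, h'⟩ ⟨rfl, hγ⟩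
      have : (reorder u x')⁻¹ * reorder u y' = γ := congrArg Subtype.val hγ
      have hy' : y' = y := (reorder_bijective hu).1 (by rw [hy, ← this, mul_inv_cancel_left])
      subst hy'
      rfl
  prod_eq_one_iff p := by
    rw [prod_darts_diagramOfLabels, inv_mul_eq_one, (reorder_bijective hu).1.eq_iff]

/-- The maximum is symmetric in the two labels, so it does not matter how `f` matches the points of
the two fibres. -/
theorem fibreMax_apply (u : ReflectedLamplighter → unitInterval)
    (f : Cay marking ≃g Cay marking) (l : Lamplighter) :
    fibreMax (fun x => u (f.symm x)) (baseMap f l) = fibreMax u l := by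
  have h1 := fibreMax_left (fun x => u (f.symm x)) (f ⟨l, 1⟩)
  rw [← apply_twin, f.symm_apply_apply, f.symm_apply_apply] at h1
  exact h1.trans (fibreMax_left u ⟨l, 1⟩).symm

/-- The comparison inside the fibre is invariant. An `f` of reflecting type exchanges the fibres
ahead and behind, which flips the second factor because `fibreMax` has no ties. -/
theorem sheet_apply (hu : Function.Injective u) (f : Cay marking ≃g Cay marking) {η : C₂}
    (hη : ∀ l i, baseMap f (l * stepSwitch i) = baseMap f l * reflectHom η (stepSwitch i))
    (x : ReflectedLamplighter) :
    sheet (fun x => u (f.symm x)) (f x) = η * sheet u x := by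
  unfold sheet
  rw [← apply_twin, left_apply, mul_left_comm]
  simp only [f.symm_apply_apply]
  congr 1
  rcases C₂.eq_one_or η with rfl | rfl
  · have h (i : Fin 4) : baseMap f x.left * stepSwitch i = baseMap f (x.left * stepSwitch i) := by
      rw [hη]; rfl
    rw [h, h, fibreMax_apply, fibreMax_apply, one_mul]
  · have h (i : Fin 4) :
        baseMap f x.left * stepSwitch i = baseMap f (x.left * stepSwitch i.rev) := by
      rw [hη, reflectHom_gen, reflect_stepSwitch, Fin.rev_rev]
    have hne : fibreMax u (x.left * stepSwitch 0) ≠ fibreMax u (x.left * stepSwitch 3) :=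
      (fibreMax_injective hu).ne ((mul_right_injective _).ne (stepSwitch_injective.ne (by decide)))
    rw [h, h, fibreMax_apply, fibreMax_apply, show Fin.rev (0 : Fin 4) = 3 from rfl,
      show Fin.rev (3 : Fin 4) = 0 from rfl]
    rcases hne.lt_or_gt with h | h
    · rw [if_pos h, if_neg h.not_gt, C₂.gen_mul_gen]
    · rw [if_pos h, if_neg h.not_gt, mul_one]

/-- The hypotheses say that one left translation, with `C₂`-component `η`, carries `x` to `x'` and
`y` to `y'`; edge labels do not see it. -/
theorem inv_mul_eq_inv_mul_of_reflectHom {x y x' y' : ReflectedLamplighter} {η : C₂}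
    (h : x'.left⁻¹ * y'.left = reflectHom η (x.left⁻¹ * y.left))
    (hx : x'.right = η * x.right) (hy : y'.right = η * y.right) : x'⁻¹ * y' = x⁻¹ * y := by
  refine SemidirectProduct.ext ?_ ?_
  · rw [left_inv_mul, left_inv_mul, h, hx, ← MulAut.mul_apply, ← map_mul, mul_inv_rev,
      inv_mul_cancel_right]
  · rw [SemidirectProduct.mul_right, SemidirectProduct.mul_right, SemidirectProduct.inv_right,
      SemidirectProduct.inv_right, hx, hy, mul_inv_rev, mul_assoc, inv_mul_cancel_left]

theorem diagramOfLabels_equivariant (hu : Function.Injective u)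
    (f : Cay marking ≃g Cay marking) :
    diagramOfLabels (fun x => u (f.symm x)) = EdgeLabelling.act f (diagramOfLabels u) := by
  obtain ⟨η, hη⟩ := exists_reflectHom f
  funext ⟨⟨x', y'⟩, h'⟩
  obtain ⟨x, rfl⟩ := f.surjective x'
  obtain ⟨y, rfl⟩ := f.surjective y'
  have h : (Cay marking).Adj x y := f.map_adj_iff.1 h'
  refine Subtype.ext ?_
  change (reorder (fun x => u (f.symm x)) (f x))⁻¹ * reorder (fun x => u (f.symm x)) (f y) =
    (reorder u (f.symm (f x)))⁻¹ * reorder u (f.symm (f y))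
  rw [f.symm_apply_apply, f.symm_apply_apply]
  exact inv_mul_eq_inv_mul_of_reflectHom (reflectHom_inv_mul_baseMap f hη h)
    (sheet_apply hu f hη x) (sheet_apply hu f hη y)

/-! ### Measurability of the factor map and of the set of Cayley diagrams. -/

theorem measurable_fibreMax (l : Lamplighter) : Measurable fun u => fibreMax u l :=
  (measurable_pi_apply _).max (measurable_pi_apply _)

theorem measurable_sheet (x : ReflectedLamplighter) :
    Measurable[_, ⊤] fun u => sheet u x := by
  let _ : MeasurableSpace C₂ := ⊤
  have : DiscreteMeasurableSpace C₂ := ⟨fun _ => trivial⟩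
  refine Measurable.mul ?_ ?_
  · exact Measurable.ite (measurableSet_lt (measurable_pi_apply _) (measurable_pi_apply _))
      measurable_const measurable_const
  · exact Measurable.ite (measurableSet_lt (measurable_fibreMax _) (measurable_fibreMax _))
      measurable_const measurable_const

theorem measurable_diagramOfLabels_apply (a : (Cay marking).Dart) :
    Measurable[_, ⊤] fun u => diagramOfLabels u a := by
  let _ : MeasurableSpace C₂ := ⊤
  have : DiscreteMeasurableSpace C₂ := ⟨fun _ => trivial⟩
  -- The label of a fixed edge depends on `u` only through two elements of `C₂`.
  let F : C₂ × C₂ → marking := fun p =>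
    ⟨(⟨a.fst.left, p.1⟩ : ReflectedLamplighter)⁻¹ * ⟨a.snd.left, p.2⟩,
      inv_mul_mem_marking_of_left_eq (x := a.fst) (y := a.snd) rfl rfl a.adj⟩
  have hF : Measurable[_, ⊤] F := @measurable_of_countable _ _ _ ⊤ _ _ F
  have hs : Measurable fun u => (sheet u a.fst, sheet u a.snd) :=
    (measurable_sheet a.fst).prodMk (measurable_sheet a.snd)
  have h : (fun u => diagramOfLabels u a) = fun u => F (sheet u a.fst, sheet u a.snd) := rfl
  rw [h]
  exact @Measurable.comp _ _ _ _ _ ⊤ F _ hF hs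

theorem measurable_diagramOfLabels : Measurable diagramOfLabels :=
  @measurable_pi_lambda _ _ (fun _ : (Cay marking).Dart => marking) _ (fun _ => ⊤) _
    measurable_diagramOfLabels_apply

theorem measurable_prod_darts {x y : ReflectedLamplighter} (p : (Cay marking).Walk x y) :
    Measurable[_, ⊤] fun d : EdgeLabelling marking =>
      (p.darts.map fun a => (d a : ReflectedLamplighter)).prod := by
  let _ : MeasurableSpace ReflectedLamplighter := ⊤
  let _ : MeasurableSpace marking := ⊤
  have : DiscreteMeasurableSpace ReflectedLamplighter := ⟨fun _ => trivial⟩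
  have : DiscreteMeasurableSpace marking := ⟨fun _ => trivial⟩
  induction p with
  | nil => exact measurable_const
  | cons h p ih =>
    simp only [SimpleGraph.Walk.darts_cons, List.map_cons, List.prod_cons]
    refine Measurable.mul ?_ ih
    exact (measurable_of_countable (Subtype.val : marking → ReflectedLamplighter)).comp
      (measurable_pi_apply (X := fun _ : (Cay marking).Dart => marking) _)

/-- Needed to transfer an almost sure statement through the push-forward. Edges and walks are
countable, so all quantifiers are. -/
theorem measurableSet_isCayleyDiagram :
    MeasurableSet {d : EdgeLabelling marking | IsCayleyDiagram d} := by
  let _ : MeasurableSpace ReflectedLamplighter := ⊤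
  let _ : MeasurableSpace marking := ⊤
  have : DiscreteMeasurableSpace marking := ⟨fun _ => trivial⟩
  have : Countable (Cay marking).Dart := Function.Injective.countable
    SimpleGraph.Dart.toProd_injective
  have (x y : ReflectedLamplighter) : Countable ((Cay marking).Walk x y) :=
    Function.Injective.countable SimpleGraph.Walk.support_injective
  have hiff (d : EdgeLabelling marking) : IsCayleyDiagram d ↔
      (∀ (x : ReflectedLamplighter) (γ : marking), ∃ a, (a.fst = x ∧ d a = γ) ∧
        ∀ b : (Cay marking).Dart, (b.fst = x ∧ d b = γ) → b = a) ∧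
      ∀ (x y : ReflectedLamplighter) (p : (Cay marking).Walk x y),
        (p.darts.map fun a => (d a : ReflectedLamplighter)).prod = 1 ↔ x = y :=
    ⟨fun h => ⟨h.1, fun _ _ => h.2⟩, fun h => ⟨h.1, fun {x y} => h.2 x y⟩⟩
  have hlabel (a : (Cay marking).Dart) (x : ReflectedLamplighter) (γ : marking) :
      Measurable fun d : EdgeLabelling marking => a.fst = x ∧ d a = γ :=
    measurable_const.and (measurableSet_setOfPred.1
      (measurable_pi_apply (X := fun _ : (Cay marking).Dart => marking) a
        (MeasurableSet.of_discrete (s := {γ}))))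
  simp only [hiff]
  refine measurableSet_setOfPred.2 (Measurable.and ?_ ?_)
  · exact Measurable.forall fun x => Measurable.forall fun γ => Measurable.exists fun a =>
      (hlabel a x γ).and (Measurable.forall fun b => (hlabel b x γ).imp measurable_const)
  · exact Measurable.forall fun x => Measurable.forall fun y => Measurable.forall fun p =>
      Measurable.iff (measurableSet_setOfPred.1 (measurable_prod_darts p (t := {1}) trivial))
        measurable_const

theorem admitsAutFIIDCayleyDiagram_marking : AdmitsAutFIIDCayleyDiagram marking := by
  refine ⟨(iidMeasure ReflectedLamplighter).map diagramOfLabels,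
    ⟨diagramOfLabels, measurable_diagramOfLabels, ?_, rfl⟩, ?_⟩
  · filter_upwards [ae_injective_iidMeasure ReflectedLamplighter] with u hu f
    exact diagramOfLabels_equivariant hu f
  · rw [ae_map_iff measurable_diagramOfLabels.aemeasurable measurableSet_isCayleyDiagram]
    filter_upwards [ae_injective_iidMeasure ReflectedLamplighter] with u hu
    exact isCayleyDiagram_diagramOfLabels hu

end ReflectedLamplighter

/-! ### The 3-regular tree with a height function -/

/-- A vertex at height `n` is a finite set of integers below `n`. -/
@[ext]
structure LampTree where
  height : ℤ
  lamps : Finset ℤ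
  lt_height : ∀ k ∈ lamps, k < height

namespace LampTree

/-- The neighbour of `v` one level below. -/
def parent (v : LampTree) : LampTree where
  height := v.height - 1
  lamps := v.lamps.filter (· < v.height - 1)
  lt_height _ hk := (Finset.mem_filter.1 hk).2

theorem mem_lamps_parent {v : LampTree} {k : ℤ} :
    k ∈ v.parent.lamps ↔ k ∈ v.lamps ∧ k < v.height - 1 := Finset.mem_filter

/-- The 3-regular tree on `LampTree`. -/
def tree : SimpleGraph LampTree where
  Adj v w := w = v.parent ∨ v = w.parent
  symm := ⟨fun _ _ h => h.symm⟩
  loopless := ⟨fun v h => by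
    have : v.height = v.height - 1 := by rcases h with h | h <;> exact congrArg height h
    omega⟩

theorem ext_mem {v w : LampTree} (hh : v.height = w.height)
    (hl : ∀ k, k ∈ v.lamps ↔ k ∈ w.lamps) : v = w :=
  LampTree.ext hh (Finset.ext hl)

/-- The neighbour of `v` one level above at which the new lamp is off. -/
def childOff (v : LampTree) : LampTree where
  height := v.height + 1
  lamps := v.lamps
  lt_height k hk := (v.lt_height k hk).trans (lt_add_one _)

/-- The neighbour of `v` one level above at which the new lamp is on. -/
def childOn (v : LampTree) : LampTree where
  height := v.height + 1
  lamps := insert v.height v.lamps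
  lt_height k hk := by
    rcases Finset.mem_insert.1 hk with rfl | hk
    · exact lt_add_one _
    · exact (v.lt_height k hk).trans (lt_add_one _)

/-- Passing to the parent forgets only the lamp at `w.height - 1`, whose state tells the two
children apart. -/
theorem eq_parent_iff {v w : LampTree} : v = w.parent ↔ w = v.childOff ∨ w = v.childOn := by
  constructor
  · rintro rfl
    by_cases h : w.height - 1 ∈ w.lamps
    · refine Or.inr (ext_mem (sub_add_cancel _ _).symm fun k => ?_)
      have := w.lt_height k
      simp only [childOn, Finset.mem_insert, mem_lamps_parent]
      constructor
      · intro hk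
        have := this hk
        by_cases hk' : k = w.height - 1
        · exact Or.inl hk'
        · exact Or.inr ⟨hk, by omega⟩
      · rintro (rfl | hk)
        · exact h
        · exact hk.1
    · refine Or.inl (ext_mem (sub_add_cancel _ _).symm fun k => ?_)
      have := w.lt_height k
      simp only [childOff, mem_lamps_parent]
      refine ⟨fun hk => ⟨hk, ?_⟩, And.left⟩
      have := this hk
      have : k ≠ w.height - 1 := fun e => h (e ▸ hk)
      omega
  · rintro (rfl | rfl) <;> refine ext_mem (add_sub_cancel_right _ _).symm fun k => ?_ <;>
      have := v.lt_height k <;> simp only [mem_lamps_parent, childOff, childOn,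
        Finset.mem_insert] <;> constructor <;> intro hk
    · exact ⟨hk, by linarith [this hk]⟩
    · exact hk.1
    · exact ⟨Or.inr hk, by linarith [this hk]⟩
    · exact hk.1.resolve_left (by rintro rfl; linarith [hk.2])

theorem childOff_ne_childOn (v : LampTree) : v.childOff ≠ v.childOn := fun h => by
  have h1 : v.height ∈ v.childOff.lamps := by rw [h]; exact Finset.mem_insert_self _ _
  exact lt_irrefl _ (v.lt_height _ h1)

theorem isHeightFunction_height : IsHeightFunction tree height where
  one_below v := by
    rw [Set.ncard_eq_one]
    refine ⟨v.parent, Set.ext fun w => ?_⟩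
    constructor
    · rintro ⟨rfl | rfl, h⟩
      · rfl
      · simp only [parent] at h; omega
    · rintro rfl
      exact ⟨Or.inl rfl, (sub_add_cancel _ _).symm⟩
  two_above v := by
    rw [Set.ncard_eq_two]
    refine ⟨v.childOff, v.childOn, childOff_ne_childOn v, Set.ext fun w => ?_⟩
    constructor
    · rintro ⟨h | h, hh⟩
      · rw [h] at hh; simp only [parent] at hh; omega
      · exact eq_parent_iff.1 h
    · intro h
      have h := eq_parent_iff.2 h
      exact ⟨Or.inr h, congrArg height h⟩
  no_other v w h := by
    rcases h with rfl | rfl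
    · exact Or.inl (sub_add_cancel _ _).symm
    · exact Or.inr rfl

theorem tree_reachable_of_forall_lt (v : LampTree) (n : ℕ) :
    ∃ w, tree.Reachable v w ∧ w.height = v.height - n ∧
      ∀ k, k ∈ w.lamps ↔ k ∈ v.lamps ∧ k < v.height - n := by
  induction n with
  | zero =>
    exact ⟨v, .rfl, by simp, fun k => ⟨fun h => ⟨h, by simpa using v.lt_height k h⟩, And.left⟩⟩
  | succ n ih =>
    obtain ⟨w, hvw, hh, hl⟩ := ih
    refine ⟨w.parent, hvw.trans (SimpleGraph.Adj.reachable (Or.inl rfl)), ?_, fun k => ?_⟩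
    · simp only [parent, hh]; push_cast; ring
    · rw [mem_lamps_parent, hl, hh]
      push_cast
      constructor
      · rintro ⟨⟨h1, h2⟩, h3⟩; exact ⟨h1, by omega⟩
      · rintro ⟨h1, h2⟩; exact ⟨⟨h1, by omega⟩, by omega⟩

/-- Far enough down every lamp has been forgotten, so the descents from any two vertices merge; this
gives connectedness. -/
theorem exists_reachable_dark (v : LampTree) : ∃ N : ℤ, ∀ n ≤ N,
    tree.Reachable v ⟨n, ∅, by simp⟩ := by
  obtain ⟨M, hM⟩ := v.lamps.bddBelow
  refine ⟨min M v.height, fun n hn => ?_⟩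
  obtain ⟨w, hw, hh, hl⟩ := tree_reachable_of_forall_lt v (v.height - n).toNat
  have hn' : v.height - ((v.height - n).toNat : ℤ) = n := by
    have := min_le_right M v.height
    omega
  rw [hn'] at hh hl
  have : w = ⟨n, ∅, by simp⟩ := by
    refine ext_mem hh fun k => ?_
    simp only [Finset.notMem_empty, hl, iff_false, not_and, not_lt]
    exact fun hk => hn.trans ((min_le_left _ _).trans (hM hk))
  exact this ▸ hw

theorem tree_connected : tree.Connected where
  nonempty := ⟨⟨0, ∅, by simp⟩⟩
  preconnected v w := by
    obtain ⟨N, hN⟩ := exists_reachable_dark v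
    obtain ⟨M, hM⟩ := exists_reachable_dark w
    exact (hN (min N M) (min_le_left _ _)).trans (hM _ (min_le_right _ _)).symm

/-- The vertices at or above `v`. -/
def above (v : LampTree) : Set LampTree :=
  {w | v.height ≤ w.height ∧ ∀ k < v.height, k ∈ w.lamps ↔ k ∈ v.lamps}

theorem self_mem_above (v : LampTree) : v ∈ above v := ⟨le_rfl, fun _ _ => Iff.rfl⟩

theorem parent_notMem_above (v : LampTree) : v.parent ∉ above v := fun h => by
  have := h.1
  simp only [parent] at this
  omega

/-- The only edge leaving `above v` is the one from `v` to its parent, so that edge is a bridge. -/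
theorem parent_mem_above_iff {v w : LampTree} (hw : w ≠ v) : w.parent ∈ above v ↔ w ∈ above v := by
  constructor
  · rintro ⟨h1, h2⟩
    simp only [parent] at h1
    refine ⟨by omega, fun k hk => ?_⟩
    rw [← h2 k hk, mem_lamps_parent]
    exact ⟨fun h => ⟨h, by omega⟩, And.left⟩
  · rintro ⟨h1, h2⟩
    have hlt : v.height < w.height := by
      refine lt_of_le_of_ne h1 fun h => hw (ext_mem h.symm fun k => ?_)
      by_cases hk : k < v.height
      · exact h2 k hk
      · exact iff_of_false (fun hk' => hk (h ▸ w.lt_height k hk')) fun hk' => hk (v.lt_height k hk')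
    refine ⟨by simp only [parent]; omega, fun k hk => ?_⟩
    rw [← h2 k hk, mem_lamps_parent]
    exact ⟨And.left, fun h => ⟨h, by omega⟩⟩

theorem not_reachable_parent (v : LampTree) :
    ¬ (tree.deleteEdges {s(v, v.parent)}).Reachable v v.parent := by
  rintro ⟨p⟩
  have step {w w' : LampTree} (h : (tree.deleteEdges {s(v, v.parent)}).Adj w w') :
      w ∈ above v ↔ w' ∈ above v := by
    rw [SimpleGraph.deleteEdges_adj] at h
    obtain ⟨rfl | rfl, hne⟩ := h
    · refine (parent_mem_above_iff ?_).symm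
      rintro rfl
      exact hne rfl
    · refine parent_mem_above_iff ?_
      rintro rfl
      exact hne Sym2.eq_swap
  have walk {w w' : LampTree} (p : (tree.deleteEdges {s(v, v.parent)}).Walk w w') :
      w ∈ above v ↔ w' ∈ above v := by
    induction p with
    | nil => rfl
    | cons h _ ih => exact (step h).trans ih
  exact parent_notMem_above v ((walk p).1 (self_mem_above v))

theorem tree_isTree : tree.IsTree where
  connected := tree_connected
  isAcyclic := by
    rw [SimpleGraph.isAcyclic_iff_forall_adj_isBridge]
    rintro v w (rfl | rfl)
    · exact SimpleGraph.isBridge_iff.2 (not_reachable_parent v)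
    · rw [Sym2.eq_swap]
      exact SimpleGraph.isBridge_iff.2 (not_reachable_parent w)

end LampTree

/-! ### The Diestel–Leader graph as a quotient -/

namespace ReflectedLamplighter

open Lamplighter LampTree

/-- The elements that do not move and touch at most the two lamps next to the origin. -/
def originSwitches : Subgroup ReflectedLamplighter where
  carrier := {γ | γ.left.pos = 0 ∧ ∀ k ∈ γ.left.lamps, k = -1 ∨ k = 0}
  one_mem' := ⟨rfl, by simp⟩
  mul_mem' := by
    rintro ⟨l, η⟩ ⟨m, θ⟩ ⟨hl, hl'⟩ ⟨hm, hm'⟩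
    -- The reflection exchanges the lamps `-1` and `0`.
    have hφ : (reflectHom η m).pos = 0 ∧ ∀ k ∈ (reflectHom η m).lamps, k = -1 ∨ k = 0 := by
      rcases C₂.eq_one_or η with rfl | rfl
      · exact ⟨hm, hm'⟩
      · rw [reflectHom_gen]
        refine ⟨neg_eq_zero.2 hm, fun k hk => ?_⟩
        rcases hm' _ (mem_lamps_reflect.1 hk) with h | h <;> omega
    simp only at hl hl'
    refine ⟨by simp [hl, hφ.1], fun k hk => ?_⟩
    rw [SemidirectProduct.mul_left, mem_lamps_mul] at hk
    rcases hk with ⟨hk, -⟩ | ⟨hk, -⟩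
    · exact hl' k hk
    · simp only [hl, sub_zero] at hk
      exact hφ.2 k hk
  inv_mem' := by
    rintro ⟨l, η⟩ ⟨hl, hl'⟩
    simp only at hl hl'
    have hi : l⁻¹.pos = 0 ∧ ∀ k ∈ l⁻¹.lamps, k = -1 ∨ k = 0 := by
      refine ⟨by simp [hl], fun k hk => hl' k ?_⟩
      rwa [mem_lamps_inv, hl, add_zero] at hk
    rcases C₂.eq_one_or η⁻¹ with h | h
    · simpa [h] using hi
    · refine ⟨?_, fun k hk => ?_⟩
      · simp only [SemidirectProduct.inv_left, h, reflectHom_gen, reflect, hi.1, neg_zero]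
      · simp only [SemidirectProduct.inv_left, h, reflectHom_gen, mem_lamps_reflect] at hk
        rcases hi.2 _ hk with h | h <;> omega

theorem finite_originSwitches : Finite originSwitches := by
  have : Function.Injective fun γ : originSwitches =>
      ((⟨γ.1.left.lamps, Finset.mem_powerset.2 fun k hk => by
        simpa using γ.2.2 k hk⟩, γ.1.right) : ({-1, 0} : Finset ℤ).powerset × C₂) := by
    intro γ δ h
    refine Subtype.ext (SemidirectProduct.ext (Lamplighter.ext ?_ ?_) (congrArg Prod.snd h))
    · rw [γ.2.1, δ.2.1]
    · exact congrArg Subtype.val (congrArg Prod.fst h)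
  exact Finite.of_injective _ this

theorem inv_mul_mem_originSwitches_iff {x y : ReflectedLamplighter} :
    x⁻¹ * y ∈ originSwitches ↔ x.left.pos = y.left.pos ∧
      ∀ k, k ≠ x.left.pos - 1 → k ≠ x.left.pos → (k ∈ x.left.lamps ↔ k ∈ y.left.lamps) := by
  have h1 : x⁻¹ * y ∈ originSwitches ↔ (x.left⁻¹ * y.left).pos = 0 ∧
      ∀ k ∈ (x.left⁻¹ * y.left).lamps, k = -1 ∨ k = 0 := by
    change ((x⁻¹ * y).left.pos = 0 ∧ ∀ k ∈ (x⁻¹ * y).left.lamps, k = -1 ∨ k = 0) ↔ _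
    rw [left_inv_mul]
    rcases C₂.eq_one_or x.right⁻¹ with h | h
    · rw [h]; rfl
    · rw [h, reflectHom_gen]
      refine and_congr neg_eq_zero ⟨fun h k hk => ?_, fun h k hk => ?_⟩
      · have := h (-1 - k) (by rwa [mem_lamps_reflect, sub_sub_cancel])
        omega
      · have := h _ (mem_lamps_reflect.1 hk)
        omega
  rw [h1, pos_mul, pos_inv, neg_add_eq_zero]
  refine and_congr_right fun hp => ⟨fun h k hk1 hk2 => ?_, fun h k hk => ?_⟩
  · by_contra hne
    have := h (k - x.left.pos) (by
      rw [mem_lamps_inv_mul, sub_add_cancel, Xor]; tauto)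
    omega
  · rw [mem_lamps_inv_mul, Xor] at hk
    by_contra hne
    have := h (k + x.left.pos) (by omega) (by omega)
    tauto

/-- The part of a lamp configuration strictly below the position, the adjacent lamp excluded. -/
def lowerPart (l : Lamplighter) : LampTree where
  height := l.pos
  lamps := (shift 1 l.lamps).filter (· < l.pos)
  lt_height _ hk := (Finset.mem_filter.1 hk).2

/-- The part of a lamp configuration strictly above the position, read downwards. -/
def upperPart (l : Lamplighter) : LampTree where
  height := -l.pos
  lamps := (l.lamps.map (Equiv.neg ℤ).toEmbedding).filter (· < -l.pos)
  lt_height _ hk := (Finset.mem_filter.1 hk).2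

theorem mem_lowerPart {l : Lamplighter} {k : ℤ} :
    k ∈ (lowerPart l).lamps ↔ k - 1 ∈ l.lamps ∧ k < l.pos := by
  simp only [lowerPart, Finset.mem_filter, mem_shift]

theorem mem_upperPart {l : Lamplighter} {k : ℤ} :
    k ∈ (upperPart l).lamps ↔ -k ∈ l.lamps ∧ k < -l.pos := by
  simp only [upperPart, Finset.mem_filter, Finset.mem_map_equiv, Equiv.neg_symm, Equiv.neg_apply]

/-- The vertex of the Diestel–Leader graph under an element of `C₂ ⋉ L`. -/
def toHorocyclic (x : ReflectedLamplighter) :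
    {p : LampTree × LampTree // p.1.height + p.2.height = 0} :=
  ⟨(lowerPart x.left, upperPart x.left), add_neg_cancel x.left.pos⟩

/-- The lower part sees the lamps below `pos - 1`, shifted by one to fill the levels below `pos`;
the upper part sees those above `pos`. Exactly the lamps `pos - 1` and `pos` are lost. -/
theorem toHorocyclic_eq_iff {x y : ReflectedLamplighter} :
    toHorocyclic x = toHorocyclic y ↔ x⁻¹ * y ∈ originSwitches := by
  rw [inv_mul_mem_originSwitches_iff, Subtype.ext_iff, Prod.ext_iff]
  constructor
  · rintro ⟨h1, h2⟩
    have hp : x.left.pos = y.left.pos := congrArg height h1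
    refine ⟨hp, fun k hk1 hk2 => ?_⟩
    rcases lt_or_gt_of_ne hk2 with hk | hk
    · have : k + 1 ∈ (lowerPart x.left).lamps ↔ k + 1 ∈ (lowerPart y.left).lamps := by
        rw [show lowerPart x.left = lowerPart y.left from h1]
      simp only [mem_lowerPart, add_sub_cancel_right] at this
      have h : k + 1 < x.left.pos := by omega
      simpa [h, hp ▸ h] using this
    · have : -k ∈ (upperPart x.left).lamps ↔ -k ∈ (upperPart y.left).lamps := by
        rw [show upperPart x.left = upperPart y.left from h2]
      simp only [mem_upperPart, neg_neg] at this
      have h : -k < -x.left.pos := by omega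
      simpa [h, hp ▸ h] using this
  · rintro ⟨hp, h⟩
    refine ⟨ext_mem hp fun k => ?_, ext_mem (congrArg Neg.neg hp) fun k => ?_⟩
    · rw [toHorocyclic, toHorocyclic, mem_lowerPart, mem_lowerPart, ← hp]
      exact and_congr_left fun hk => h _ (by omega) (by omega)
    · rw [toHorocyclic, toHorocyclic, mem_upperPart, mem_upperPart, ← hp]
      exact and_congr_left fun hk => h _ (by omega) (by omega)

/-- A configuration with prescribed lamps below and above the position. -/
def glue (n : ℤ) (v w : LampTree) : Lamplighter :=
  ⟨n, shift (-1) v.lamps ∪ w.lamps.map (Equiv.neg ℤ).toEmbedding⟩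

theorem mem_lamps_glue {n : ℤ} {v w : LampTree} {k : ℤ} :
    k ∈ (glue n v w).lamps ↔ k + 1 ∈ v.lamps ∨ -k ∈ w.lamps := by
  simp only [glue, Finset.mem_union, mem_shift, sub_neg_eq_add, Finset.mem_map_equiv,
    Equiv.neg_symm, Equiv.neg_apply]

theorem glue_mul_stepSwitch (n : ℤ) (v w : LampTree) :
    glue n v w * stepSwitch 3 = glue (n + 1) v w := by
  refine ext_mem rfl fun k => ?_
  simp [mem_lamps_mul, mem_lamps_glue, stepSwitch, Xor]

/-- The height bound allows one more than `-n`, because the same lamps are read at both ends of an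
edge, at positions `n` and `n + 1`. -/
theorem lowerPart_glue {n : ℤ} {v w : LampTree} (hv : v.height = n) (hw : w.height ≤ 1 - n) :
    lowerPart (glue n v w) = v := by
  refine ext_mem hv.symm fun k => ?_
  have h1 := v.lt_height k
  have h2 := w.lt_height (-(k - 1))
  simp only [mem_lowerPart, mem_lamps_glue, sub_add_cancel]
  refine ⟨fun ⟨hk, hlt⟩ => hk.resolve_right fun hk => ?_, fun hk => ⟨Or.inl hk, hv ▸ h1 hk⟩⟩
  have := h2 hk
  simp only [glue] at hlt
  omega

theorem upperPart_glue {n : ℤ} {v w : LampTree} (hv : v.height ≤ n + 1) (hw : w.height = -n) :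
    upperPart (glue n v w) = w := by
  refine ext_mem hw.symm fun k => ?_
  have h1 := v.lt_height (-k + 1)
  have h2 := w.lt_height k
  simp only [mem_upperPart, mem_lamps_glue, neg_neg]
  refine ⟨fun ⟨hk, hlt⟩ => hk.resolve_left fun hk => ?_, fun hk => ⟨Or.inr hk, hw ▸ h2 hk⟩⟩
  have := h1 hk
  simp only [glue] at hlt
  omega

theorem toHorocyclic_surjective : Function.Surjective toHorocyclic := by
  rintro ⟨⟨v, w⟩, h⟩
  simp only at h
  exact ⟨⟨glue v.height v w, 1⟩, Subtype.ext (Prod.ext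
    (lowerPart_glue rfl (by omega)) (upperPart_glue (by omega) (by omega)))⟩

/-- A step forward brings the lamp `l.pos - 1` into the lower part, and the parent forgets just that
lamp. Dually, the upper part loses the lamp `l.pos + 1`. -/
theorem lowerPart_mul_stepSwitch (l : Lamplighter) :
    (lowerPart (l * stepSwitch 3)).parent = lowerPart l := by
  refine ext_mem (add_sub_cancel_right _ _) fun k => ?_
  simp only [mem_lamps_parent, mem_lowerPart, mem_lamps_mul]
  simp only [lowerPart, pos_mul, stepSwitch, Xor]
  simp
  omega

theorem upperPart_mul_stepSwitch (l : Lamplighter) :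
    upperPart (l * stepSwitch 3) = (upperPart l).parent := by
  refine ext_mem (neg_add _ _) fun k => ?_
  have h : (stepSwitch 3).lamps = ∅ := rfl
  have hp : (l * stepSwitch 3).pos = l.pos + 1 := rfl
  have hh : (upperPart l).height = -l.pos := rfl
  rw [mem_lamps_parent, mem_upperPart, mem_upperPart, mem_lamps_mul, h, hp, hh, Xor]
  simp only [Finset.notMem_empty, not_false_eq_true, and_true, false_and, or_false]
  exact ⟨fun h => ⟨⟨h.1, by omega⟩, by omega⟩, fun h => ⟨h.1.1, by omega⟩⟩

theorem adj_toHorocyclic_of_mul {x y : ReflectedLamplighter}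
    (h : y.left = x.left * stepSwitch 3) :
    (horocyclicProduct tree height).Adj (toHorocyclic x) (toHorocyclic y) := by
  refine ⟨Or.inr ?_, Or.inl ?_⟩
  · simp only [toHorocyclic, h, lowerPart_mul_stepSwitch]
  · simp only [toHorocyclic, h, upperPart_mul_stepSwitch]

theorem exists_of_parent {p q : {p : LampTree × LampTree // p.1.height + p.2.height = 0}}
    (h1 : p.1.1 = q.1.1.parent) (h2 : q.1.2 = p.1.2.parent) :
    ∃ x y, toHorocyclic x = p ∧ toHorocyclic y = q ∧ (Cay marking).Adj x y := by
  obtain ⟨⟨v, w⟩, hp⟩ := p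
  obtain ⟨⟨v', w'⟩, hq⟩ := q
  simp only at h1 h2 hp
  have hh : v.height = v'.height - 1 := congrArg height h1
  -- The higher vertex of each coordinate pair determines the lower one, so `v'` and `w` carry all
  -- the data; the lamp at `v.height` is left off.
  set l := glue v.height v' w
  have hw : upperPart l = w := upperPart_glue (by omega) (by omega)
  have hv : lowerPart (l * stepSwitch 3) = v' := by
    rw [glue_mul_stepSwitch]
    exact lowerPart_glue (by omega) (by omega)
  refine ⟨⟨l, 1⟩, ⟨l * stepSwitch 3, 1⟩, Subtype.ext (Prod.ext ?_ hw),
    Subtype.ext (Prod.ext hv ?_), adj_iff.2 ⟨3, rfl⟩⟩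
  · exact (lowerPart_mul_stepSwitch l).symm.trans ((congrArg parent hv).trans h1.symm)
  · exact (upperPart_mul_stepSwitch l).trans ((congrArg parent hw).trans h2.symm)

theorem horocyclic_adj_iff {p q : {p : LampTree × LampTree // p.1.height + p.2.height = 0}} :
    (horocyclicProduct tree height).Adj p q ↔
      p ≠ q ∧ ∃ x y, toHorocyclic x = p ∧ toHorocyclic y = q ∧ (Cay marking).Adj x y := by
  constructor
  · intro h
    refine ⟨h.ne, ?_⟩
    have hp := p.2
    have hq := q.2
    obtain ⟨h1 | h1, h2 | h2⟩ := h <;> have e1 := congrArg height h1 <;>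
      have e2 := congrArg height h2 <;> simp only [parent] at e1 e2
    -- Heights sum to zero, so the two coordinates cannot both go down, nor, below, both go up.
    · omega
    · obtain ⟨x, y, hx, hy, hxy⟩ := exists_of_parent h1 h2
      exact ⟨y, x, hy, hx, hxy.symm⟩
    · exact exists_of_parent h1 h2
    · omega
  · rintro ⟨hne, x, y, rfl, rfl, h⟩
    obtain ⟨i, hi⟩ := adj_iff.1 h
    -- Switches stay inside a coset, so only steps join distinct cosets.
    have hswitch (k : ℤ) (hk : k = -1 ∨ k = 0) : y.left ≠ x.left * ⟨0, {k}⟩ := fun hi => by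
      refine hne (toHorocyclic_eq_iff.2 (inv_mul_mem_originSwitches_iff.2 ⟨?_, fun j h1 h2 => ?_⟩))
      · simp [hi]
      · rw [hi, mem_lamps_mul, Finset.mem_singleton, Xor]
        have : j - x.left.pos ≠ k := by omega
        tauto
    fin_cases i
    · refine (adj_toHorocyclic_of_mul ?_).symm
      have h1 : stepSwitch 0 * stepSwitch 3 = 1 := by decide
      exact (by rw [mul_assoc, h1, mul_one] :
        x.left = x.left * stepSwitch 0 * stepSwitch 3).trans (congrArg (· * stepSwitch 3) hi.symm)
    · exact absurd hi (hswitch _ (Or.inl rfl))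
    · exact absurd hi (hswitch _ (Or.inr rfl))
    · exact adj_toHorocyclic_of_mul hi

/-- The quotient by `originSwitches` as the vertex set of the Diestel–Leader graph. -/
noncomputable def quotientEquiv : ReflectedLamplighter ⧸ originSwitches ≃
    {p : LampTree × LampTree // p.1.height + p.2.height = 0} :=
  Equiv.ofBijective
    (Quotient.lift toHorocyclic fun _ _ h =>
      toHorocyclic_eq_iff.2 (QuotientGroup.leftRel_apply.1 h))
    ⟨by
      rintro ⟨x⟩ ⟨y⟩ h
      exact QuotientGroup.eq.2 (toHorocyclic_eq_iff.1 h),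
    fun p => let ⟨x, hx⟩ := toHorocyclic_surjective p; ⟨QuotientGroup.mk x, hx⟩⟩

theorem quotientEquiv_mk (x : ReflectedLamplighter) :
    quotientEquiv (x : ReflectedLamplighter ⧸ originSwitches) = toHorocyclic x := rfl

theorem isDiestelLeaderGraph_cosetQuotient :
    IsDiestelLeaderGraph (cosetQuotient (Cay marking) originSwitches) := by
  refine ⟨LampTree, tree, height, tree_isTree, isHeightFunction_height, ⟨quotientEquiv, ?_⟩⟩
  intro a b
  rw [horocyclic_adj_iff, quotientEquiv.injective.ne_iff]
  simp only [← quotientEquiv_mk, quotientEquiv.apply_eq_iff_eq]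
  rfl

end ReflectedLamplighter

theorem mainTheorem10 :
    ∃ φ : Multiplicative (ZMod 2) →* MulAut Lamplighter,
      (∀ r ∈ Lamplighter.dlGenerators, φ (Multiplicative.ofAdd 1) r = r⁻¹) ∧
      ∃ E : Set (Lamplighter ⋊[φ] Multiplicative (ZMod 2)),
        IsMarking E ∧
        (∃ K : Subgroup (Lamplighter ⋊[φ] Multiplicative (ZMod 2)),
          Finite K ∧ IsDiestelLeaderGraph (cosetQuotient (Cay E) K)) ∧
        Nontrivial (rotations (Cay E)) ∧
        AdmitsAutFIIDCayleyDiagram E :=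
  ⟨Lamplighter.reflectHom, fun _ => Lamplighter.reflectHom_gen_of_mem_dlGenerators,
    ReflectedLamplighter.marking, ReflectedLamplighter.isMarking_marking,
    ⟨ReflectedLamplighter.originSwitches, ReflectedLamplighter.finite_originSwitches,
      ReflectedLamplighter.isDiestelLeaderGraph_cosetQuotient⟩,
    ReflectedLamplighter.nontrivial_rotations,
    ReflectedLamplighter.admitsAutFIIDCayleyDiagram_marking⟩
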